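/- Let $\mathrm{Ai}(x)=\frac1\pi\int_0^\infty\cos\left(\frac{t^3}{3}+xt\right)dt$ (improper integral) be the Airy function and let $q:\mathbb R\to\mathbb R$ be the solution of the Painlevé II equation $q''(x)=xq(x)+2q(x)^3$ on $\mathbb R$ with $q(x)\sim\mathrm{Ai}(x)$ as $x\to\infty$. Let \[ F_2(x)=\exp\left(-\int_x^\infty (y-x)q(y)^2\,dy\right),\qquad F_1(x)=F_2(x)^{1/2}\exp\left(-\frac12\int_x^\infty q(y)\,dy\right), \] so that $F_1$ is the cumulative distribution function of the Tracy--Widom distribution of the Gaussian orthogonal ensemble. For positive integers $m$ put \[ b_m=F_1^{-1}\left(1-\frac1m\right),\qquad a_m=\frac{1}{m\,F_1'(b_m)}, \] where $F_1^{-1}(u)=\sup\{x\in\mathbb R: F_1(x)<u\}$ is the inverse (quantile) function of $F_1$. Then, as $m\to\infty$, \[ a_m\sim\left[\frac43\right]^{1/2}\left[\frac34\right]^{1/6}\left(\log\frac{m^2}{12\pi}\right)^{-1/3}, \qquad b_m\sim\left[\frac34\right]^{2/3}\left(\log\frac{m^2}{12\pi}\right)^{2/3}. \] In particular $\lim_{m\to\infty}a_m=0$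 and $\lim_{m\to\infty}b_m=\infty$. -/

import Mathlib

open Filter Topology MeasureTheory Asymptotics

noncomputable section

/-- The Airy function `Ai x = (1/π) ∫₀^∞ cos (t³/3 + x t) dt`; the integral converges only
conditionally, so it is the limit of the integrals over `[0, R]`. -/
def airyAi (x : ℝ) : ℝ :=
  limUnder atTop (fun R : ℝ => (1 / Real.pi) * ∫ t in (0 : ℝ)..R, Real.cos (t ^ 3 / 3 + x * t))

/-- `q` is the solution on the real line of the Painlevé II equation `q'' = x q + 2 q³` with
`q x ∼ Ai x` as `x → ∞`. -/
structure IsPainleveTW (q : ℝ → ℝ) : Prop where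
  differentiable : Differentiable ℝ q
  painleve : ∀ x : ℝ, HasDerivAt (deriv q) (x * q x + 2 * q x ^ 3) x
  equiv_airy : q ~[atTop] airyAi

/-- The Tracy–Widom (GUE) distribution function attached to `q`. -/
def tracyWidomF2 (q : ℝ → ℝ) (x : ℝ) : ℝ :=
  Real.exp (-∫ y in Set.Ioi x, (y - x) * q y ^ 2)

/-- The Tracy–Widom (GOE) distribution function attached to `q`. -/
def tracyWidomF1 (q : ℝ → ℝ) (x : ℝ) : ℝ :=
  tracyWidomF2 q x ^ (1 / 2 : ℝ) * Real.exp (-(1 / 2) * ∫ y in Set.Ioi x, q y)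

/-- The (left-continuous) inverse `F⁻¹ p = sup {x | F x < p}` of a distribution function. For a
nondecreasing `F` and `p` strictly between its limits it equals `inf {x | p ≤ F x}`. -/
def quantile (F : ℝ → ℝ) (p : ℝ) : ℝ :=
  sSup {x : ℝ | F x < p}

/-- For a strictly increasing `F`, `quantile F` is the inverse function on the range of `F`. -/
theorem quantile_apply {F : ℝ → ℝ} (hF : StrictMono F) (x : ℝ) : quantile F (F x) = x := by
  have h : {y : ℝ | F y < F x} = Set.Iio x := by
    ext y
    exact hF.lt_iff_lt
  rw [quantile, h, csSup_Iio]

/-- The centring constants `b_m = F₁⁻¹ (1 - 1/m)`. -/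
def normB (q : ℝ → ℝ) (m : ℕ) : ℝ :=
  quantile (tracyWidomF1 q) (1 - 1 / (m : ℝ))

/-- The scaling constants `a_m = 1 / (m F₁' (b_m))`. -/
def normA (q : ℝ → ℝ) (m : ℕ) : ℝ :=
  1 / ((m : ℝ) * deriv (tracyWidomF1 q) (normB q m))

end

/-! Write g_s(x) = exp(-(2/3) x^{3/2}) x^{-s} (`airyGauge`). Moving the Airy contour to the saddle
height √x gives Ai ∼ g_{1/4}/(2√π), hence the same for q. Since q → 0, terms with q² are negligible,
so F₁' ∼ q/2 ∼ d g_{1/4} with d = 1/(4√π). Integrating from infinity adds 1/2 to the index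
(`tendsto_antideriv_div_airyGauge`), so 1 - F₁ ∼ d g_{3/4}. As F₁(b_m) = 1 - 1/m, m g_{3/4}(b_m) →
1/d; logarithms give log(m²/K) ∼ (4/3) b_m^{3/2} for any K > 0 (`tendsto_log_mul_div_rpow`). Also
a_m = (1 - F₁)/F₁' at b_m, so a_m ∼ g_{3/4}/g_{1/4} = b_m^{-1/2}. Both asymptotics follow by taking
powers. -/

/-! ### Saddle-point asymptotics of the Airy function. -/

theorem airy_phase_shift (a t : ℝ) :
    Complex.I * (((t : ℂ) + a * Complex.I) ^ 3 / 3 + (a : ℂ) ^ 2 * (t + a * Complex.I)) =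
      ((-(2 / 3) * a ^ 3 - a * t ^ 2 : ℝ) : ℂ) + ((t ^ 3 / 3 : ℝ) : ℂ) * Complex.I := by
  push_cast
  linear_combination ((a : ℂ) * t ^ 2 + Complex.I * (a : ℂ) ^ 2 * t + (Complex.I ^ 2 - 1) * a ^ 3 / 3 + (a : ℂ) ^ 3) * Complex.I_sq

theorem norm_exp_airy_phase (x R y : ℝ) :
    ‖Complex.exp (Complex.I * (((R : ℂ) + y * Complex.I) ^ 3 / 3 +
      (x : ℂ) * (R + y * Complex.I)))‖ = Real.exp (y ^ 3 / 3 - R ^ 2 * y - x * y) := by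
  have h : Complex.I * (((R : ℂ) + y * Complex.I) ^ 3 / 3 + (x : ℂ) * (R + y * Complex.I)) =
      ((y ^ 3 / 3 - R ^ 2 * y - x * y : ℝ) : ℂ) +
        ((R ^ 3 / 3 - R * y ^ 2 + x * R : ℝ) : ℂ) * Complex.I := by
    push_cast
    linear_combination ((R : ℂ) ^ 2 * y + Complex.I * (R : ℂ) * y ^ 2 +
      (Complex.I ^ 2 - 1) * y ^ 3 / 3 + x * y) * Complex.I_sq
  rw [Complex.norm_exp, h, Complex.add_re, Complex.ofReal_re, Complex.re_ofReal_mul, Complex.I_re,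
    mul_zero, add_zero]

/-- The integrand has modulus at most exp(a³/3 - R² y), which vanishes as R → ∞ for each y > 0. -/
theorem tendsto_airy_side_integral (a : ℝ) (ha : 0 < a) :
    Tendsto (fun R : ℝ => ∫ y in (0 : ℝ)..a, Complex.exp (Complex.I *
      (((R : ℂ) + y * Complex.I) ^ 3 / 3 + (a : ℂ) ^ 2 * (R + y * Complex.I)))) atTop (𝓝 0) := by
  have key : Tendsto (fun R : ℝ => ∫ y in (0 : ℝ)..a, Complex.exp (Complex.I *
      (((R : ℂ) + y * Complex.I) ^ 3 / 3 + (a : ℂ) ^ 2 * (R + y * Complex.I)))) atTop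
      (𝓝 (∫ y in (0 : ℝ)..a, (0 : ℂ))) := by
    refine intervalIntegral.tendsto_integral_filter_of_dominated_convergence
      (fun _ => Real.exp (a ^ 3 / 3)) ?_ ?_ ?_ ?_
    · refine Eventually.of_forall fun R => Continuous.aestronglyMeasurable ?_
      fun_prop
    · refine Eventually.of_forall fun R => Eventually.of_forall fun y hy => ?_
      rw [Set.uIoc_of_le ha.le] at hy
      have h := norm_exp_airy_phase (a ^ 2) R y
      push_cast at h
      rw [h]
      refine Real.exp_le_exp.2 ?_
      have h1 : y ^ 3 ≤ a ^ 3 := pow_le_pow_left₀ hy.1.le hy.2 3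
      have h2 : 0 ≤ R ^ 2 * y := mul_nonneg (sq_nonneg R) hy.1.le
      have h3 : 0 ≤ a ^ 2 * y := mul_nonneg (sq_nonneg a) hy.1.le
      linarith
    · exact intervalIntegrable_const
    · refine Eventually.of_forall fun y hy => ?_
      rw [Set.uIoc_of_le ha.le] at hy
      rw [tendsto_zero_iff_norm_tendsto_zero]
      have h : ∀ R : ℝ, ‖Complex.exp (Complex.I *
          (((R : ℂ) + y * Complex.I) ^ 3 / 3 + (a : ℂ) ^ 2 * (R + y * Complex.I)))‖ =
          Real.exp (-(R ^ 2 * y) + (y ^ 3 / 3 - a ^ 2 * y)) := by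
        intro R
        have h := norm_exp_airy_phase (a ^ 2) R y
        push_cast at h
        rw [h]
        congr 1
        ring
      simp_rw [h]
      refine Real.tendsto_exp_atBot.comp (tendsto_atBot_add_const_right _ _ ?_)
      exact tendsto_neg_atTop_atBot.comp
        ((tendsto_pow_atTop two_ne_zero).atTop_mul_const hy.1)
  simpa using key

/-- Cauchy's theorem on the rectangle with corners 0 and R + ia. At height a the phase has no term
linear in t, leaving a Gaussian factor. On the imaginary axis the integrand is real and dz = i dy,
so that side has no real part. -/
theorem integral_cos_airy_phase_eq (a R : ℝ) :
    ∫ t in (0 : ℝ)..R, Real.cos (t ^ 3 / 3 + a ^ 2 * t) =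
      Real.exp (-(2 / 3) * a ^ 3) * (∫ t in (0 : ℝ)..R, Real.exp (-a * t ^ 2) * Real.cos (t ^ 3 / 3))
        - (Complex.I * ∫ y in (0 : ℝ)..a, Complex.exp (Complex.I *
      (((R : ℂ) + y * Complex.I) ^ 3 / 3 + (a : ℂ) ^ 2 * (R + y * Complex.I)))).re := by
  have hre : ∀ (u v : ℝ) (f : ℝ → ℂ), Continuous f →
      (∫ t in u..v, f t).re = ∫ t in u..v, (f t).re := fun u v f hf =>
    (Complex.reCLM.intervalIntegral_comp_comm (hf.intervalIntegrable u v)).symm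
  have him : ∀ (u v : ℝ) (f : ℝ → ℂ), Continuous f →
      (∫ t in u..v, f t).im = ∫ t in u..v, (f t).im := fun u v f hf =>
    (Complex.imCLM.intervalIntegral_comp_comm (hf.intervalIntegrable u v)).symm
  have hrect := Complex.integral_boundary_rect_eq_zero_of_differentiableOn
    (fun z : ℂ => Complex.exp (Complex.I * (z ^ 3 / 3 + (a : ℂ) ^ 2 * z)))
    0 (R + a * Complex.I) (by fun_prop)
  simp only [Complex.zero_re, Complex.zero_im, Complex.add_re, Complex.add_im, Complex.mul_re,
    Complex.mul_im, Complex.ofReal_re, Complex.ofReal_im, Complex.I_re, Complex.I_im, mul_zero,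
    mul_one, zero_mul, sub_zero, add_zero, zero_add, Complex.ofReal_zero, smul_eq_mul] at hrect
  have h1 : (∫ t in (0 : ℝ)..R, Complex.exp (Complex.I * ((t : ℂ) ^ 3 / 3 + (a : ℂ) ^ 2 * t))).re =
      ∫ t in (0 : ℝ)..R, Real.cos (t ^ 3 / 3 + a ^ 2 * t) := by
    rw [hre _ _ _ (by fun_prop)]
    congr 1
    ext t
    have : Complex.I * ((t : ℂ) ^ 3 / 3 + (a : ℂ) ^ 2 * t) =
        ((t ^ 3 / 3 + a ^ 2 * t : ℝ) : ℂ) * Complex.I := by push_cast; ring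
    rw [this, Complex.exp_ofReal_mul_I_re]
  have h2 : (∫ t in (0 : ℝ)..R, Complex.exp (Complex.I *
      (((t : ℂ) + a * Complex.I) ^ 3 / 3 + (a : ℂ) ^ 2 * (t + a * Complex.I)))).re =
      Real.exp (-(2 / 3) * a ^ 3) *
        ∫ t in (0 : ℝ)..R, Real.exp (-a * t ^ 2) * Real.cos (t ^ 3 / 3) := by
    rw [hre _ _ _ (by fun_prop), ← intervalIntegral.integral_const_mul]
    congr 1
    ext t
    rw [airy_phase_shift, Complex.exp_add, ← Complex.ofReal_exp, Complex.re_ofReal_mul,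
      Complex.exp_ofReal_mul_I_re, ← mul_assoc, ← Real.exp_add]
    ring_nf
  have h3 : (Complex.I * ∫ y in (0 : ℝ)..a, Complex.exp (Complex.I *
      (((y : ℂ) * Complex.I) ^ 3 / 3 + (a : ℂ) ^ 2 * (y * Complex.I)))).re = 0 := by
    rw [Complex.I_mul_re, him _ _ _ (by fun_prop), neg_eq_zero]
    refine intervalIntegral.integral_zero_ae (Eventually.of_forall fun y _ => ?_)
    have : Complex.I * (((y : ℂ) * Complex.I) ^ 3 / 3 + (a : ℂ) ^ 2 * (y * Complex.I)) =
        ((y ^ 3 / 3 - a ^ 2 * y : ℝ) : ℂ) := by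
      push_cast
      linear_combination ((Complex.I ^ 2 - 1) * (y : ℂ) ^ 3 / 3 + (a : ℂ) ^ 2 * y) * Complex.I_sq
    rw [this, Complex.exp_ofReal_im]
  have h := congrArg Complex.re hrect
  simp only [Complex.add_re, Complex.sub_re, Complex.zero_re] at h
  rw [h1, h2, h3] at h
  linarith

theorem integrable_exp_mul_cos_cube (a : ℝ) (ha : 0 < a) :
    IntegrableOn (fun t : ℝ => Real.exp (-a * t ^ 2) * Real.cos (t ^ 3 / 3)) (Set.Ioi 0) := by
  refine ((integrable_exp_neg_mul_sq ha).integrableOn).mono'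
    (Continuous.aestronglyMeasurable (by fun_prop)) (Eventually.of_forall fun t => ?_)
  rw [norm_mul, Real.norm_eq_abs, Real.abs_exp, Real.norm_eq_abs]
  exact mul_le_of_le_one_right (Real.exp_pos _).le (Real.abs_cos_le_one _)

/-- The Airy function at a positive point as an integral over a horizontal line through its
saddle point. -/
theorem airyAi_sq_eq (a : ℝ) (ha : 0 < a) :
    airyAi (a ^ 2) = (1 / Real.pi) * (Real.exp (-(2 / 3) * a ^ 3) *
      ∫ t in Set.Ioi (0 : ℝ), Real.exp (-a * t ^ 2) * Real.cos (t ^ 3 / 3)) := by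
  refine Tendsto.limUnder_eq (Tendsto.const_mul _ ?_)
  simp_rw [integral_cos_airy_phase_eq a]
  have h1 := (intervalIntegral_tendsto_integral_Ioi 0 (integrable_exp_mul_cos_cube a ha)
    tendsto_id).const_mul (Real.exp (-(2 / 3) * a ^ 3))
  have h2 := (Complex.continuous_re.tendsto _).comp
    ((tendsto_airy_side_integral a ha).const_mul Complex.I)
  simpa using h1.sub h2

/-- Used with b = x^{1/4}: after s = bt the Gaussian is fixed and only the cosine depends on b,
tending to 1. -/
theorem integral_exp_mul_cos_cube_rescale (b : ℝ) (hb : 0 < b) :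
    b * ∫ t in Set.Ioi (0 : ℝ), Real.exp (-b ^ 2 * t ^ 2) * Real.cos (t ^ 3 / 3) =
      ∫ s in Set.Ioi (0 : ℝ), Real.exp (-s ^ 2) * Real.cos ((s / b) ^ 3 / 3) := by
  have h := integral_comp_mul_left_Ioi
    (fun s => Real.exp (-s ^ 2) * Real.cos ((s / b) ^ 3 / 3)) 0 hb
  rw [mul_zero, smul_eq_mul] at h
  rw [eq_comm, ← inv_mul_eq_iff_eq_mul₀ hb.ne', ← h]
  congr 1
  ext t
  rw [mul_div_cancel_left₀ _ hb.ne', mul_pow, neg_mul]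

theorem tendsto_integral_exp_mul_cos_cube :
    Tendsto (fun b : ℝ => ∫ s in Set.Ioi (0 : ℝ), Real.exp (-s ^ 2) * Real.cos ((s / b) ^ 3 / 3))
      atTop (𝓝 (√Real.pi / 2)) := by
  have hlim : ∫ s in Set.Ioi (0 : ℝ), Real.exp (-s ^ 2) = √Real.pi / 2 := by
    simpa using integral_gaussian_Ioi 1
  rw [← hlim]
  refine tendsto_integral_filter_of_dominated_convergence (fun s => Real.exp (-s ^ 2)) ?_ ?_ ?_ ?_
  · exact Eventually.of_forall fun b => Continuous.aestronglyMeasurable (by fun_prop)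
  · refine Eventually.of_forall fun b => Eventually.of_forall fun s => ?_
    rw [norm_mul, Real.norm_eq_abs, Real.abs_exp, Real.norm_eq_abs]
    exact mul_le_of_le_one_right (Real.exp_pos _).le (Real.abs_cos_le_one _)
  · have h : Integrable fun s : ℝ => Real.exp (-s ^ 2) := by
      simpa using integrable_exp_neg_mul_sq one_pos
    exact h.restrict
  · refine Eventually.of_forall fun s => ?_
    have h : Tendsto (fun b : ℝ => s / b) atTop (𝓝 0) := tendsto_const_nhds.div_atTop tendsto_id
    have h2 : Tendsto (fun b : ℝ => Real.exp (-s ^ 2) * Real.cos ((s / b) ^ 3 / 3)) atTop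
        (𝓝 (Real.exp (-s ^ 2) * Real.cos (0 ^ 3 / 3))) :=
      ((Real.continuous_cos.tendsto _).comp ((h.pow 3).div_const 3)).const_mul _
    simpa using h2

/-! ### Calculus of the gauge functions. -/

/-- `exp (-(2/3) x^{3/2}) x^{-s}`, the gauge functions for the decay of the Airy function. -/
noncomputable def airyGauge (s x : ℝ) : ℝ :=
  Real.exp (-(2 / 3) * x ^ (3 / 2 : ℝ)) * x ^ (-s)

theorem airyGauge_pos (s : ℝ) {x : ℝ} (hx : 0 < x) : 0 < airyGauge s x :=
  mul_pos (Real.exp_pos _) (Real.rpow_pos_of_pos hx _)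

/-- The leading behaviour of the Airy function: `Ai x ∼ exp (-(2/3) x^{3/2}) / (2 √π x^{1/4})`. -/
theorem tendsto_airyAi_div_gauge :
    Tendsto (fun x => airyAi x / airyGauge (1 / 4) x) atTop (𝓝 (1 / (2 * √Real.pi))) := by
  have hb : Tendsto (fun x : ℝ => x ^ (1 / 4 : ℝ)) atTop atTop :=
    tendsto_rpow_atTop (by norm_num)
  have h := (tendsto_integral_exp_mul_cos_cube.comp hb).const_mul (1 / Real.pi)
  have hc : 1 / Real.pi * (√Real.pi / 2) = 1 / (2 * √Real.pi) := by
    have := Real.sq_sqrt Real.pi_pos.le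
    have h0 : √Real.pi ≠ 0 := (Real.sqrt_pos.2 Real.pi_pos).ne'
    field_simp
    linarith
  rw [hc] at h
  refine h.congr' ?_
  filter_upwards [eventually_gt_atTop 0] with x hx
  set b := x ^ (1 / 4 : ℝ) with hbdef
  have hb0 : 0 < b := Real.rpow_pos_of_pos hx _
  have hx4 : (b ^ 2) ^ 2 = x := by
    rw [← pow_mul, hbdef, ← Real.rpow_natCast, ← Real.rpow_mul hx.le]
    norm_num
  have hx6 : (b ^ 2) ^ 3 = x ^ (3 / 2 : ℝ) := by
    rw [← pow_mul, hbdef, ← Real.rpow_natCast, ← Real.rpow_mul hx.le]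
    norm_num
  have hg : airyGauge (1 / 4) x = Real.exp (-(2 / 3) * (b ^ 2) ^ 3) * b⁻¹ := by
    rw [airyGauge, hx6, hbdef, Real.rpow_neg hx.le]
  have hA := airyAi_sq_eq (b ^ 2) (by positivity)
  rw [hx4] at hA
  rw [hg, hA, Function.comp_apply, ← integral_exp_mul_cos_cube_rescale b hb0]
  have := (Real.exp_pos (-(2 / 3) * (b ^ 2) ^ 3)).ne'
  field_simp

theorem airyGauge_div_airyGauge (s t : ℝ) {x : ℝ} (hx : 0 < x) :
    airyGauge s x / airyGauge t x = x ^ (t - s) := by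
  rw [airyGauge, airyGauge, mul_div_mul_left _ _ (Real.exp_pos _).ne', ← Real.rpow_sub hx]
  ring_nf

theorem airyGauge_mul_rpow (s t : ℝ) {x : ℝ} (hx : 0 < x) :
    airyGauge s x * x ^ t = airyGauge (s - t) x := by
  rw [airyGauge, airyGauge, mul_assoc, ← Real.rpow_add hx]
  ring_nf

theorem hasDerivAt_airyGauge (s : ℝ) {x : ℝ} (hx : 0 < x) :
    HasDerivAt (airyGauge s) (-(airyGauge (s - 1 / 2) x + s * airyGauge (s + 1) x)) x := by
  have h1 : HasDerivAt (fun y : ℝ => Real.exp (-(2 / 3) * y ^ (3 / 2 : ℝ)))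
      (Real.exp (-(2 / 3) * x ^ (3 / 2 : ℝ)) * (-(2 / 3) * (3 / 2 * x ^ (3 / 2 - 1 : ℝ)))) x :=
    ((Real.hasDerivAt_rpow_const (Or.inl hx.ne')).const_mul _).exp
  have h2 : HasDerivAt (fun y : ℝ => y ^ (-s)) (-s * x ^ (-s - 1)) x :=
    Real.hasDerivAt_rpow_const (Or.inl hx.ne')
  convert! h1.mul h2 using 1
  simp only [airyGauge]
  rw [show -(s - 1 / 2) = (3 / 2 - 1 : ℝ) + -s by ring, Real.rpow_add hx,
    show -(s + 1) = -s - 1 by ring]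
  ring

theorem airyGauge_isLittleO_exp_neg (s : ℝ) :
    airyGauge s =o[atTop] fun x : ℝ => Real.exp (-1 * x) := by
  refine (isLittleO_iff_tendsto fun x h => absurd h (Real.exp_pos _).ne').2 ?_
  refine squeeze_zero' ?_ ?_ (tendsto_rpow_mul_exp_neg_mul_atTop_nhds_zero (-s) 1 one_pos)
  · filter_upwards [eventually_gt_atTop 0] with x hx
    exact div_nonneg (airyGauge_pos s hx).le (Real.exp_pos _).le
  -- For x ≥ 9, √x ≥ 3 gives (2/3) x^{3/2} ≥ 2x: one x pays for the divisor exp(-x), the other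
  -- remains.
  · filter_upwards [eventually_ge_atTop 9] with x hx
    have hx0 : 0 < x := by linarith
    have h3 : (3 : ℝ) ≤ x ^ (1 / 2 : ℝ) := by
      rw [← Real.sqrt_eq_rpow]
      exact Real.le_sqrt_of_sq_le (by linarith)
    have h32 : x ^ (3 / 2 : ℝ) = x * x ^ (1 / 2 : ℝ) := by
      rw [← Real.rpow_one_add' hx0.le (by norm_num)]
      norm_num
    rw [div_le_iff₀ (Real.exp_pos _), airyGauge, mul_assoc, ← Real.exp_add, mul_comm]
    refine mul_le_mul_of_nonneg_left (Real.exp_le_exp.2 ?_) (Real.rpow_nonneg hx0.le _)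
    rw [h32]
    nlinarith

theorem tendsto_airyGauge (s : ℝ) : Tendsto (airyGauge s) atTop (𝓝 0) := by
  refine (airyGauge_isLittleO_exp_neg s).trans_tendsto ?_
  simpa using Real.tendsto_exp_neg_atTop_nhds_zero

theorem isBigO_airyGauge_of_tendsto {f : ℝ → ℝ} {s c : ℝ}
    (h : Tendsto (fun x => f x / airyGauge s x) atTop (𝓝 c)) : f =O[atTop] airyGauge s := by
  refine isBigO_of_div_tendsto_nhds ?_ c h
  filter_upwards [eventually_gt_atTop 0] with x hx h0
  exact absurd h0 (airyGauge_pos s hx).ne'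

theorem isBigO_exp_neg_of_tendsto {f : ℝ → ℝ} {s c : ℝ}
    (h : Tendsto (fun x => f x / airyGauge s x) atTop (𝓝 c)) :
    f =O[atTop] fun x : ℝ => Real.exp (-1 * x) :=
  (isBigO_airyGauge_of_tendsto h).trans (airyGauge_isLittleO_exp_neg s).isBigO

theorem tendsto_rpow_mul_of_tendsto_div_airyGauge {f : ℝ → ℝ} {s c : ℝ} (t : ℝ)
    (h : Tendsto (fun x => f x / airyGauge s x) atTop (𝓝 c)) :
    Tendsto (fun x => x ^ t * f x) atTop (𝓝 0) := by
  have h1 := h.mul (tendsto_airyGauge (s - t))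
  rw [mul_zero] at h1
  refine h1.congr' ?_
  filter_upwards [eventually_gt_atTop 0] with x hx
  rw [← airyGauge_mul_rpow s t hx, ← mul_assoc, div_mul_cancel₀ _ (airyGauge_pos s hx).ne', mul_comm]

theorem tendsto_of_tendsto_div_airyGauge {f : ℝ → ℝ} {s c : ℝ}
    (h : Tendsto (fun x => f x / airyGauge s x) atTop (𝓝 c)) : Tendsto f atTop (𝓝 0) := by
  simpa using tendsto_rpow_mul_of_tendsto_div_airyGauge 0 h

theorem tendsto_div_airyGauge_of_lt {f : ℝ → ℝ} {s t c : ℝ} (hts : t < s)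
    (h : Tendsto (fun x => f x / airyGauge s x) atTop (𝓝 c)) :
    Tendsto (fun x => f x / airyGauge t x) atTop (𝓝 0) := by
  have h1 := h.mul (tendsto_rpow_neg_atTop (sub_pos.2 hts))
  rw [mul_zero] at h1
  refine h1.congr' ?_
  filter_upwards [eventually_gt_atTop 0] with x hx
  rw [neg_sub, ← airyGauge_div_airyGauge s t hx, div_mul_div_cancel₀ (airyGauge_pos s hx).ne']

/-- If `G' = -f`, `G → 0` and `f ∼ c airyGauge s`, then `G ∼ c airyGauge (s + 1/2)`. -/
theorem tendsto_antideriv_div_airyGauge {f G : ℝ → ℝ} {s c : ℝ}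
    (hG : ∀ x, HasDerivAt G (-f x) x) (hG0 : Tendsto G atTop (𝓝 0))
    (h : Tendsto (fun x => f x / airyGauge s x) atTop (𝓝 c)) :
    Tendsto (fun x => G x / airyGauge (s + 1 / 2) x) atTop (𝓝 c) := by
  have hden : Tendsto (fun x : ℝ => 1 + (s + 1 / 2) * x ^ (-(3 / 2) : ℝ)) atTop (𝓝 1) := by
    simpa using ((tendsto_rpow_neg_atTop (show (0 : ℝ) < 3 / 2 by norm_num)).const_mul
      (s + 1 / 2)).const_add 1
  have hfac : ∀ x : ℝ, 0 < x → airyGauge (s + 1 / 2 - 1 / 2) x +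
      (s + 1 / 2) * airyGauge (s + 1 / 2 + 1) x =
      airyGauge s x * (1 + (s + 1 / 2) * x ^ (-(3 / 2) : ℝ)) := by
    intro x hx
    have h2 := airyGauge_mul_rpow s (-(3 / 2)) hx
    rw [show s - -(3 / 2) = s + 1 / 2 + 1 by ring] at h2
    rw [add_sub_cancel_right, ← h2]
    ring
  -- L'Hôpital: the derivative of g_{s+1/2} is -g_s (1 + (s + 1/2) x^{-3/2}), and the bracket tends
  -- to 1.
  refine HasDerivAt.lhopital_zero_atTop (f' := fun x => -f x)
    (g' := fun x => -(airyGauge (s + 1 / 2 - 1 / 2) x + (s + 1 / 2) * airyGauge (s + 1 / 2 + 1) x))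
    (Eventually.of_forall hG) ?_ ?_ hG0 (tendsto_airyGauge _) ?_
  · filter_upwards [eventually_gt_atTop 0] with x hx using hasDerivAt_airyGauge _ hx
  · filter_upwards [eventually_gt_atTop 0, hden.eventually_ne one_ne_zero] with x hx h1
    rw [hfac x hx, neg_ne_zero]
    exact mul_ne_zero (airyGauge_pos s hx).ne' h1
  · have h3 := h.div hden one_ne_zero
    rw [div_one] at h3
    refine h3.congr' ?_
    filter_upwards [eventually_gt_atTop 0] with x hx
    rw [hfac x hx, neg_div_neg_eq, Pi.div_apply, div_div]

/-! ### Tail integrals of q and q². -/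

theorem integrableOn_Ioi_of_isBigO_exp_neg {f : ℝ → ℝ} (hf : Continuous f)
    (h : f =O[atTop] fun x : ℝ => Real.exp (-1 * x)) (a : ℝ) : IntegrableOn f (Set.Ioi a) :=
  integrable_of_isBigO_exp_neg one_pos hf.continuousOn h

theorem integral_Ioi_eq_sub {f : ℝ → ℝ} (hi : ∀ a, IntegrableOn f (Set.Ioi a)) (x : ℝ) :
    ∫ y in Set.Ioi x, f y = (∫ y in Set.Ioi 0, f y) - ∫ y in (0 : ℝ)..x, f y := by
  rw [← intervalIntegral.integral_Ioi_sub_Ioi' (hi 0) (hi x)]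
  ring

theorem hasDerivAt_integral_Ioi {f : ℝ → ℝ} (hf : Continuous f)
    (hi : ∀ a, IntegrableOn f (Set.Ioi a)) (x : ℝ) :
    HasDerivAt (fun x => ∫ y in Set.Ioi x, f y) (-f x) x := by
  rw [funext (integral_Ioi_eq_sub hi)]
  exact (hf.integral_hasStrictDerivAt 0 x).hasDerivAt.const_sub _

theorem tendsto_integral_Ioi_zero {f : ℝ → ℝ} (hi : ∀ a, IntegrableOn f (Set.Ioi a)) :
    Tendsto (fun x => ∫ y in Set.Ioi x, f y) atTop (𝓝 0) := by
  rw [funext (integral_Ioi_eq_sub hi)]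
  simpa using (intervalIntegral_tendsto_integral_Ioi 0 (hi 0) tendsto_id).const_sub
    (∫ y in Set.Ioi 0, f y)

theorem tendsto_integral_Ioi_div_airyGauge {f : ℝ → ℝ} {s c : ℝ} (hf : Continuous f)
    (h : Tendsto (fun x => f x / airyGauge s x) atTop (𝓝 c)) :
    Tendsto (fun x => (∫ y in Set.Ioi x, f y) / airyGauge (s + 1 / 2) x) atTop (𝓝 c) := by
  have hi := integrableOn_Ioi_of_isBigO_exp_neg hf (isBigO_exp_neg_of_tendsto h)
  exact tendsto_antideriv_div_airyGauge (hasDerivAt_integral_Ioi hf hi)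
    (tendsto_integral_Ioi_zero hi) h

/-- One factor q tends to 0; this crude bound is all that is needed. -/
theorem tendsto_mul_self_div_airyGauge {q : ℝ → ℝ} {s c : ℝ}
    (h : Tendsto (fun x => q x / airyGauge s x) atTop (𝓝 c)) :
    Tendsto (fun x => q x ^ 2 / airyGauge s x) atTop (𝓝 0) := by
  have h1 := (tendsto_of_tendsto_div_airyGauge h).mul h
  rw [zero_mul] at h1
  refine h1.congr fun x => ?_
  ring

theorem tendsto_id_mul_sq_div_airyGauge {q : ℝ → ℝ} {s c : ℝ}
    (h : Tendsto (fun x => q x / airyGauge s x) atTop (𝓝 c)) :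
    Tendsto (fun x => x * q x ^ 2 / airyGauge s x) atTop (𝓝 0) := by
  have h1 := (tendsto_rpow_mul_of_tendsto_div_airyGauge 1 h).mul h
  rw [zero_mul] at h1
  refine h1.congr fun x => ?_
  rw [Real.rpow_one]
  ring

section WeightedTail

variable {q : ℝ → ℝ} {s c : ℝ}

theorem integral_Ioi_sub_mul_sq_eq (hq : Continuous q)
    (h : Tendsto (fun x => q x / airyGauge s x) atTop (𝓝 c)) (x : ℝ) :
    ∫ y in Set.Ioi x, (y - x) * q y ^ 2 =
      (∫ y in Set.Ioi x, y * q y ^ 2) - x * ∫ y in Set.Ioi x, q y ^ 2 := by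
  have h1 := integrableOn_Ioi_of_isBigO_exp_neg (f := fun y => y * q y ^ 2) (by fun_prop)
    (isBigO_exp_neg_of_tendsto (tendsto_id_mul_sq_div_airyGauge h)) x
  have h2 := integrableOn_Ioi_of_isBigO_exp_neg (f := fun y => q y ^ 2) (by fun_prop)
    (isBigO_exp_neg_of_tendsto (tendsto_mul_self_div_airyGauge h)) x
  rw [← integral_const_mul, ← integral_sub h1 (h2.const_mul x)]
  congr 1
  ext y
  ring

theorem hasDerivAt_integral_Ioi_sub_mul_sq (hq : Continuous q)
    (h : Tendsto (fun x => q x / airyGauge s x) atTop (𝓝 c)) (x : ℝ) :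
    HasDerivAt (fun x => ∫ y in Set.Ioi x, (y - x) * q y ^ 2)
      (-∫ y in Set.Ioi x, q y ^ 2) x := by
  have h1 := hasDerivAt_integral_Ioi (f := fun y => y * q y ^ 2) (by fun_prop)
    (integrableOn_Ioi_of_isBigO_exp_neg (by fun_prop)
      (isBigO_exp_neg_of_tendsto (tendsto_id_mul_sq_div_airyGauge h))) x
  have h2 := hasDerivAt_integral_Ioi (f := fun y => q y ^ 2) (by fun_prop)
    (integrableOn_Ioi_of_isBigO_exp_neg (by fun_prop)
      (isBigO_exp_neg_of_tendsto (tendsto_mul_self_div_airyGauge h))) x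
  rw [funext (integral_Ioi_sub_mul_sq_eq hq h)]
  -- The boundary terms ∓x q(x)² of the two pieces cancel.
  convert! h1.sub ((hasDerivAt_id x).mul h2) using 1
  simp only [id]
  ring

theorem tendsto_integral_Ioi_sub_mul_sq_div_airyGauge (hq : Continuous q)
    (h : Tendsto (fun x => q x / airyGauge s x) atTop (𝓝 c)) :
    Tendsto (fun x => (∫ y in Set.Ioi x, (y - x) * q y ^ 2) / airyGauge (s + 1 / 2) x)
      atTop (𝓝 0) := by
  have h1 := tendsto_integral_Ioi_div_airyGauge (f := fun y => y * q y ^ 2) (by fun_prop)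
    (tendsto_id_mul_sq_div_airyGauge h)
  have h2 := tendsto_integral_Ioi_div_airyGauge (f := fun y => q y ^ 2) (by fun_prop)
    (tendsto_mul_self_div_airyGauge h)
  have h0 : Tendsto (fun x => ∫ y in Set.Ioi x, (y - x) * q y ^ 2) atTop (𝓝 0) := by
    rw [funext (integral_Ioi_sub_mul_sq_eq hq h)]
    simpa using (tendsto_of_tendsto_div_airyGauge h1).sub
      (tendsto_rpow_mul_of_tendsto_div_airyGauge 1 h2)
  exact tendsto_div_airyGauge_of_lt (by linarith)
    (tendsto_antideriv_div_airyGauge (hasDerivAt_integral_Ioi_sub_mul_sq hq h) h0 h2)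

end WeightedTail

/-! ### The distribution function F₁ and its density. -/

section TracyWidomDensity

variable {q : ℝ → ℝ} {c : ℝ}

theorem tracyWidomF1_eq_exp (q : ℝ → ℝ) (x : ℝ) : tracyWidomF1 q x =
    Real.exp (-((∫ y in Set.Ioi x, (y - x) * q y ^ 2) + ∫ y in Set.Ioi x, q y) / 2) := by
  rw [tracyWidomF1, tracyWidomF2, ← Real.exp_mul, ← Real.exp_add]
  congr 1
  ring

theorem hasDerivAt_tracyWidomF1 (hq : Continuous q)
    (h : Tendsto (fun x => q x / airyGauge (1 / 4) x) atTop (𝓝 c)) (x : ℝ) :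
    HasDerivAt (tracyWidomF1 q)
      (tracyWidomF1 q x * (((∫ y in Set.Ioi x, q y ^ 2) + q x) / 2)) x := by
  have h1 := hasDerivAt_integral_Ioi_sub_mul_sq hq h x
  have h2 := hasDerivAt_integral_Ioi hq
    (integrableOn_Ioi_of_isBigO_exp_neg hq (isBigO_exp_neg_of_tendsto h)) x
  have h3 := ((h1.add h2).neg.div_const 2).exp
  rw [show tracyWidomF1 q = _ from funext (tracyWidomF1_eq_exp q)]
  convert! h3 using 1
  simp only [Pi.add_apply, Pi.neg_apply]
  ring

theorem tendsto_tracyWidomF1 (hq : Continuous q)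
    (h : Tendsto (fun x => q x / airyGauge (1 / 4) x) atTop (𝓝 c)) :
    Tendsto (tracyWidomF1 q) atTop (𝓝 1) := by
  have h1 := tendsto_of_tendsto_div_airyGauge (tendsto_integral_Ioi_sub_mul_sq_div_airyGauge hq h)
  have h2 := tendsto_of_tendsto_div_airyGauge (tendsto_integral_Ioi_div_airyGauge hq h)
  rw [show tracyWidomF1 q = _ from funext (tracyWidomF1_eq_exp q)]
  have h3 := (Real.continuous_exp.tendsto _).comp ((h1.add h2).neg.div_const 2)
  simpa [Function.comp_def] using h3

theorem tendsto_deriv_tracyWidomF1_div_airyGauge (hq : Continuous q)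
    (h : Tendsto (fun x => q x / airyGauge (1 / 4) x) atTop (𝓝 c)) :
    Tendsto (fun x => tracyWidomF1 q x * (((∫ y in Set.Ioi x, q y ^ 2) + q x) / 2) /
      airyGauge (1 / 4) x) atTop (𝓝 (c / 2)) := by
  have h1 := tendsto_div_airyGauge_of_lt (t := 1 / 4) (by norm_num)
    (tendsto_integral_Ioi_div_airyGauge (f := fun y => q y ^ 2) (by fun_prop)
      (tendsto_mul_self_div_airyGauge h))
  have h2 := (tendsto_tracyWidomF1 hq h).mul ((h1.add h).div_const 2)
  rw [one_mul, zero_add] at h2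
  refine h2.congr fun x => ?_
  ring

end TracyWidomDensity

/-! ### Quantiles of a continuous function with limit 1. -/

/-- Monotonicity is not needed: the supremum is a limit of points where F < p, and F ≥ p everywhere
to its right. -/
theorem apply_quantile {F : ℝ → ℝ} (hF : Continuous F) {p : ℝ} (hne : {x | F x < p}.Nonempty)
    (hbdd : BddAbove {x | F x < p}) : F (quantile F p) = p := by
  refine le_antisymm ?_ ?_
  · exact closure_lt_subset_le hF continuous_const (csSup_mem_closure hne hbdd)
  · refine ge_of_tendsto (hF.continuousWithinAt (s := Set.Ioi (quantile F p))) ?_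
    filter_upwards [self_mem_nhdsWithin] with y hy
    exact not_lt.1 fun hlt => (le_csSup hbdd hlt).not_gt hy

theorem bddAbove_setOf_lt_of_tendsto {F : ℝ → ℝ} {p l : ℝ} (h : Tendsto F atTop (𝓝 l))
    (hp : p < l) : BddAbove {x | F x < p} := by
  obtain ⟨X, hX⟩ := eventually_atTop.1 (h.eventually_const_lt hp)
  exact ⟨X, fun x hx => not_lt.1 fun hlt => (hX x hlt.le).not_gt hx⟩

section Quantile

variable {F f : ℝ → ℝ} {d : ℝ}

theorem tendsto_one_sub_div_airyGauge (hF : ∀ x, HasDerivAt F (f x) x)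
    (hlim : Tendsto F atTop (𝓝 1))
    (hf : Tendsto (fun x => f x / airyGauge (1 / 4) x) atTop (𝓝 d)) :
    Tendsto (fun x => (1 - F x) / airyGauge (3 / 4) x) atTop (𝓝 d) := by
  have h := tendsto_antideriv_div_airyGauge (fun x => (hF x).const_sub 1)
    (by simpa using hlim.const_sub 1) hf
  norm_num at h
  exact h

theorem eventually_lt_one_of_tendsto (hd : 0 < d)
    (hG : Tendsto (fun x => (1 - F x) / airyGauge (3 / 4) x) atTop (𝓝 d)) :
    ∀ᶠ x in atTop, F x < 1 := by
  filter_upwards [hG.eventually_const_lt hd, eventually_gt_atTop 0] with x h hx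
  rwa [div_pos_iff_of_pos_right (airyGauge_pos _ hx), sub_pos] at h

/-- There are arbitrarily large x with F x < 1; each satisfies F x < 1 - 1/m for large m, hence
bounds the supremum from below. -/
theorem tendsto_quantile_atTop (hlim : Tendsto F atTop (𝓝 1)) (hlt : ∀ᶠ x in atTop, F x < 1) :
    Tendsto (fun m : ℕ => quantile F (1 - 1 / (m : ℝ))) atTop atTop := by
  refine tendsto_atTop.2 fun K => ?_
  obtain ⟨x, hx, hKx⟩ := (hlt.and (eventually_ge_atTop K)).exists
  have hp : Tendsto (fun m : ℕ => 1 - 1 / (m : ℝ)) atTop (𝓝 1) := by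
    simpa using tendsto_one_div_atTop_nhds_zero_nat.const_sub (1 : ℝ)
  filter_upwards [hp.eventually_const_lt hx, eventually_gt_atTop 0] with m hm hm0
  have hm1 : 1 - 1 / (m : ℝ) < 1 := sub_lt_self _ (by positivity)
  exact hKx.trans (le_csSup (bddAbove_setOf_lt_of_tendsto hlim hm1) hm)

theorem eventually_apply_quantile (hF : Continuous F) (hlim : Tendsto F atTop (𝓝 1))
    (hlt : ∀ᶠ x in atTop, F x < 1) :
    ∀ᶠ m : ℕ in atTop, F (quantile F (1 - 1 / (m : ℝ))) = 1 - 1 / (m : ℝ) := by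
  obtain ⟨x, hx⟩ := hlt.exists
  have hp : Tendsto (fun m : ℕ => 1 - 1 / (m : ℝ)) atTop (𝓝 1) := by
    simpa using tendsto_one_div_atTop_nhds_zero_nat.const_sub (1 : ℝ)
  filter_upwards [hp.eventually_const_lt hx, eventually_gt_atTop 0] with m hm hm0
  have hm1 : 1 - 1 / (m : ℝ) < 1 := sub_lt_self _ (by positivity)
  exact apply_quantile hF ⟨x, hm⟩ (bddAbove_setOf_lt_of_tendsto hlim hm1)

end Quantile

/-! ### Inverting the tail asymptotics. -/

theorem log_airyGauge (s : ℝ) {x : ℝ} (hx : 0 < x) :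
    Real.log (airyGauge s x) = -(2 / 3) * x ^ (3 / 2 : ℝ) - s * Real.log x := by
  rw [airyGauge, Real.log_mul (Real.exp_pos _).ne' (Real.rpow_pos_of_pos hx _).ne', Real.log_exp,
    Real.log_rpow hx]
  ring

theorem tendsto_log_mul_div_rpow {b : ℕ → ℝ} {s e K : ℝ} (hb : Tendsto b atTop atTop) (he : 0 < e)
    (hK : 0 < K) (h : Tendsto (fun m : ℕ => (m : ℝ) * airyGauge s (b m)) atTop (𝓝 e)) :
    Tendsto (fun m : ℕ => Real.log ((m : ℝ) ^ 2 / K) / b m ^ (3 / 2 : ℝ)) atTop (𝓝 (4 / 3)) := by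
  have hpow : Tendsto (fun m => b m ^ (3 / 2 : ℝ)) atTop atTop :=
    (tendsto_rpow_atTop (by norm_num)).comp hb
  have h1 := (h.log he.ne').div_atTop hpow
  have h2 : Tendsto (fun m => Real.log (b m) / b m ^ (3 / 2 : ℝ)) atTop (𝓝 0) :=
    ((isLittleO_log_rpow_atTop (show (0 : ℝ) < 3 / 2 by norm_num)).tendsto_div_nhds_zero).comp hb
  have h3 : Tendsto (fun m => Real.log K / b m ^ (3 / 2 : ℝ)) atTop (𝓝 0) :=
    tendsto_const_nhds.div_atTop hpow
  -- log(m²/K) = 2 log(m g_s(b)) + 2s log b - log K + (4/3) b^{3/2}; only the last term has order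
  -- b^{3/2}, so K is immaterial.
  have h4 := ((h1.const_mul 2).add ((h2.const_mul (2 * s)).sub h3)).add_const (4 / 3)
  norm_num at h4
  refine h4.congr' ?_
  filter_upwards [hb.eventually_gt_atTop 0, eventually_gt_atTop 0] with m hbm hm
  have hm' : (m : ℝ) ≠ 0 := by positivity
  have hx : b m ^ (3 / 2 : ℝ) ≠ 0 := (Real.rpow_pos_of_pos hbm _).ne'
  rw [Real.log_mul hm' (airyGauge_pos s hbm).ne', log_airyGauge s hbm,
    Real.log_div (pow_ne_zero 2 hm') hK.ne', Real.log_pow]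
  field_simp
  push_cast
  ring

theorem tendsto_rpow_two_thirds {ι : Type*} {l : Filter ι} {b L : ι → ℝ}
    (hb : Tendsto b l atTop) (h : Tendsto (fun i => L i / b i ^ (3 / 2 : ℝ)) l (𝓝 (4 / 3))) :
    Tendsto (fun i => b i / L i ^ (2 / 3 : ℝ)) l (𝓝 ((3 / 4 : ℝ) ^ (2 / 3 : ℝ))) := by
  have h1 := (h.inv₀ (by norm_num)).rpow_const (p := 2 / 3) (Or.inl (by norm_num))
  norm_num at h1
  refine h1.congr' ?_
  filter_upwards [hb.eventually_gt_atTop 0, h.eventually_const_lt (show (0 : ℝ) < 4 / 3 by norm_num)]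
    with i hbi hLi
  have hL : 0 < L i := (div_pos_iff_of_pos_right (Real.rpow_pos_of_pos hbi _)).1 hLi
  rw [Real.div_rpow (Real.rpow_nonneg hbi.le _) hL.le, ← Real.rpow_mul hbi.le]
  norm_num

/-- The cube root of L/b^{3/2} carries b^{-1/2}, which cancels the b^{1/2} multiplying a. -/
theorem tendsto_rpow_one_third {ι : Type*} {l : Filter ι} {a b L : ι → ℝ}
    (hb : Tendsto b l atTop) (h : Tendsto (fun i => L i / b i ^ (3 / 2 : ℝ)) l (𝓝 (4 / 3)))
    (ha : Tendsto (fun i => a i * b i ^ (1 / 2 : ℝ)) l (𝓝 1)) :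
    Tendsto (fun i => a i / L i ^ (-(1 / 3) : ℝ)) l (𝓝 ((4 / 3 : ℝ) ^ (1 / 3 : ℝ))) := by
  have h1 := ha.mul (h.rpow_const (p := 1 / 3) (Or.inl (by norm_num)))
  rw [one_mul] at h1
  refine h1.congr' ?_
  filter_upwards [hb.eventually_gt_atTop 0, h.eventually_const_lt (show (0 : ℝ) < 4 / 3 by norm_num)]
    with i hbi hLi
  have hL : 0 < L i := (div_pos_iff_of_pos_right (Real.rpow_pos_of_pos hbi _)).1 hLi
  have hx : b i ^ (1 / 2 : ℝ) ≠ 0 := (Real.rpow_pos_of_pos hbi _).ne'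
  rw [Real.div_rpow hL.le (Real.rpow_nonneg hbi.le _), ← Real.rpow_mul hbi.le,
    Real.rpow_neg hL.le, show (3 / 2 * (1 / 3) : ℝ) = 1 / 2 by norm_num]
  field_simp

theorem isEquivalent_const_mul_of_tendsto_div {ι : Type*} {l : Filter ι} {u v : ι → ℝ} {K : ℝ}
    (hK : K ≠ 0) (hv : ∀ᶠ i in l, v i ≠ 0) (h : Tendsto (fun i => u i / v i) l (𝓝 K)) :
    u ~[l] fun i => K * v i := by
  rw [isEquivalent_iff_tendsto_one (hv.mono fun i hi => mul_ne_zero hK hi)]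
  have h1 := h.div_const K
  rw [div_self hK] at h1
  refine h1.congr fun i => ?_
  rw [Pi.div_apply, div_div, mul_comm K]

theorem IsPainleveTW.tendsto_div_airyGauge {q : ℝ → ℝ} (hq : IsPainleveTW q) :
    Tendsto (fun x => q x / airyGauge (1 / 4) x) atTop (𝓝 (1 / (2 * √Real.pi))) := by
  have hpos : (0 : ℝ) < 1 / (2 * √Real.pi) := by
    have := Real.sqrt_pos.2 Real.pi_pos
    positivity
  have hne : ∀ᶠ x in atTop, airyAi x ≠ 0 := by
    filter_upwards [tendsto_airyAi_div_gauge.eventually_ne hpos.ne'] with x hx h0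
    exact hx (by rw [h0, zero_div])
  have h := ((isEquivalent_iff_tendsto_one hne).1 hq.equiv_airy).mul tendsto_airyAi_div_gauge
  rw [one_mul] at h
  refine h.congr' ?_
  filter_upwards [hne] with x hx
  rw [Pi.div_apply, div_mul_div_cancel₀ hx]

theorem lemma2 (q : ℝ → ℝ) (hq : IsPainleveTW q) :
    ((fun m : ℕ => normA q m) ~[atTop] fun m : ℕ =>
        (4 / 3 : ℝ) ^ (1 / 2 : ℝ) * (3 / 4 : ℝ) ^ (1 / 6 : ℝ) *
          Real.log ((m : ℝ) ^ 2 / (12 * Real.pi)) ^ (-(1 / 3) : ℝ)) ∧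
    ((fun m : ℕ => normB q m) ~[atTop] fun m : ℕ =>
        (3 / 4 : ℝ) ^ (2 / 3 : ℝ) *
          Real.log ((m : ℝ) ^ 2 / (12 * Real.pi)) ^ (2 / 3 : ℝ)) ∧
    Tendsto (fun m : ℕ => normA q m) atTop (𝓝 0) ∧
    Tendsto (fun m : ℕ => normB q m) atTop atTop := by
  have hcont : Continuous q := hq.differentiable.continuous
  have hg := hq.tendsto_div_airyGauge
  set d : ℝ := 1 / (2 * √Real.pi) / 2
  have hd : 0 < d := by
    have := Real.sqrt_pos.2 Real.pi_pos
    positivity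
  have hF := hasDerivAt_tracyWidomF1 hcont hg
  have hlim := tendsto_tracyWidomF1 hcont hg
  have hf := tendsto_deriv_tracyWidomF1_div_airyGauge hcont hg
  set f : ℝ → ℝ := fun x => tracyWidomF1 q x * (((∫ y in Set.Ioi x, q y ^ 2) + q x) / 2)
  have hG := tendsto_one_sub_div_airyGauge hF hlim hf
  have hlt := eventually_lt_one_of_tendsto hd hG
  have hb : Tendsto (fun m : ℕ => normB q m) atTop atTop := tendsto_quantile_atTop hlim hlt
  have hFb : ∀ᶠ m : ℕ in atTop, tracyWidomF1 q (normB q m) = 1 - 1 / (m : ℝ) :=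
    eventually_apply_quantile (continuous_iff_continuousAt.2 fun x => (hF x).continuousAt) hlim hlt
  have hmg : Tendsto (fun m : ℕ => (m : ℝ) * airyGauge (3 / 4) (normB q m)) atTop (𝓝 d⁻¹) := by
    refine ((hG.comp hb).inv₀ hd.ne').congr' ?_
    filter_upwards [hFb] with m hm
    rw [Function.comp_apply, hm, sub_sub_cancel, inv_div, div_div_eq_mul_div, div_one, mul_comm]
  have hL := tendsto_log_mul_div_rpow hb (inv_pos.2 hd)
    (show 0 < 12 * Real.pi by positivity) hmg
  have hab : Tendsto (fun m : ℕ => normA q m * normB q m ^ (1 / 2 : ℝ)) atTop (𝓝 1) := by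
    -- The constants d⁻¹ and d cancel, and the reciprocal of m f(b) g_{3/4}(b)/g_{1/4}(b) is a_m
    -- b^{1/2}.
    have h := (hmg.mul (hf.comp hb)).inv₀ (by positivity)
    rw [inv_mul_cancel₀ hd.ne', inv_one] at h
    refine h.congr' ?_
    filter_upwards [hb.eventually_gt_atTop 0] with m hm
    have hgauge := airyGauge_div_airyGauge (1 / 4) (3 / 4) hm
    rw [show (3 / 4 - 1 / 4 : ℝ) = 1 / 2 by norm_num] at hgauge
    rw [normA, (hF _).deriv, ← hgauge, Function.comp_apply, mul_inv, mul_inv, inv_div]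
    change _ = 1 / (m * f (normB q m)) * _
    rw [one_div (_ * _), mul_inv]
    ring
  have hLpos : ∀ᶠ m : ℕ in atTop, 0 < Real.log ((m : ℝ) ^ 2 / (12 * Real.pi)) := by
    filter_upwards [hb.eventually_gt_atTop 0,
      hL.eventually_const_lt (show (0 : ℝ) < 4 / 3 by norm_num)] with m hbm hm
    exact (div_pos_iff_of_pos_right (Real.rpow_pos_of_pos hbm _)).1 hm
  -- The exponents combine as 1/2 - 1/6 = 1/3.
  have hK : (4 / 3 : ℝ) ^ (1 / 2 : ℝ) * (3 / 4 : ℝ) ^ (1 / 6 : ℝ) = (4 / 3 : ℝ) ^ (1 / 3 : ℝ) := by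
    rw [show (3 / 4 : ℝ) = (4 / 3)⁻¹ by norm_num, Real.inv_rpow (by norm_num),
      ← Real.rpow_neg (by norm_num), ← Real.rpow_add (by norm_num)]
    norm_num
  refine ⟨?_, ?_, ?_, hb⟩
  · rw [hK]
    exact isEquivalent_const_mul_of_tendsto_div (by positivity)
      (hLpos.mono fun m hm => (Real.rpow_pos_of_pos hm _).ne') (tendsto_rpow_one_third hb hL hab)
  · exact isEquivalent_const_mul_of_tendsto_div (by positivity)
      (hLpos.mono fun m hm => (Real.rpow_pos_of_pos hm _).ne') (tendsto_rpow_two_thirds hb hL)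
  · have h := hab.mul ((tendsto_rpow_neg_atTop (show (0 : ℝ) < 1 / 2 by norm_num)).comp hb)
    rw [mul_zero] at h
    refine h.congr' ?_
    filter_upwards [hb.eventually_gt_atTop 0] with m hm
    rw [Function.comp_apply, mul_assoc, ← Real.rpow_add hm, add_neg_cancel, Real.rpow_zero, mul_one]
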